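/- Let $n\ge 2$ and let $\mathbb{R}^{2,n-2}$ be $\mathbb{R}^n$ with the inner product $\langle x,y\rangle=-x_1y_1-x_2y_2+x_3y_3+\dots+x_ny_n$. A vector $v$ is called timelike if $\langle v,v\rangle<0$, lightlike if $v\neq0$ and $\langle v,v\rangle=0$, and causal if $\langle v,v\rangle\le 0$; a covector $\alpha$ is called timelike, lightlike or causal if its dual vector $\alpha^\sharp$, defined by $\langle\alpha^\sharp,x\rangle=\alpha(x)$, is so. For a $2$-form $\omega$ let $b$ be the skew-adjoint endomorphism with $\langle bX,Y\rangle=\omega(X,Y)$. For a finite family of pairs $(A_i,B_i)$ of square matrices of equal size we say that $\omega$ has the normal form composed of the blocks $(A_i,B_i)$ if there is a basis of $\mathbb{R}^{2,n-2}$ in which the Gram matrix of $\langle\cdot,\cdot\rangle$ is block diagonal with blocks $A_i$ and the matrix of $b$ (whose $j$-th column is the image of the $j$-th basis vector) is block diagonal with blocks $B_i$. Consider the following blocks, where $$S=\begin{pmatrix}0&0&0&-1\\0&0&1&0\\0&1&0&0\\-1&0&0&0\end{pmatrix}:$$ * zero block of length $l\ge 0$: $A=I_l$, $B=0$; * $B(\nu)$,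 $\nu\ne0$: $A=I_2$, $B=\begin{pmatrix}0&-\nu\\ \nu&0\end{pmatrix}$; * $B_{Ia}$: $A=S$, $B=\begin{pmatrix}0&0&1&0\\0&0&0&1\\0&0&0&0\\0&0&0&0\end{pmatrix}$; * $B_{Ib}$: $A=\begin{pmatrix}0&0&1\\0&-1&0\\1&0&0\end{pmatrix}$, $B=\begin{pmatrix}0&1&0\\0&0&1\\0&0&0\end{pmatrix}$; * $B_{II}(\nu)$, $\nu\neq0$: $A=-I_2$, $B=\begin{pmatrix}0&-\nu\\ \nu&0\end{pmatrix}$; * $B_{IIa}^{\pm}(\nu)$, $\nu\neq 0$: $A=\pm S$, $B=\begin{pmatrix}0&-\nu&1&0\\ \nu&0&0&1\\0&0&0&-\nu\\0&0&\nu&0\end{pmatrix}$; * $B_{IIb}(\xi,\nu)$, $\xi,\nu\neq0$: $A=\begin{pmatrix}0&0&1&0\\0&0&0&-1\\1&0&0&0\\0&-1&0&0\end{pmatrix}$, $B=\begin{pmatrix}\xi&-\nu&0&0\\ \nu&\xi&0&0\\0&0&-\xi&\nu\\0&0&-\nu&-\xi\end{pmatrix}$. Let $\omega$ be a $2$-form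 on $\mathbb{R}^{2,n-2}$ such that the covector $T\lrcorner\,\omega=\omega(T,\cdot)$ is causal for every timelike vector $T$. 1. If there is a timelike $T$ such that $T\lrcorner\,\omega$ is lightlike, then $\omega$ has the normal form composed of one block $B_{Ia}$ or $B_{Ib}$ and a zero block (of length $l\ge0$). 2. If $T\lrcorner\,\omega$ is timelike for all timelike $T$, then $\omega$ has the normal form composed of one block of the form $B_{II}(\nu)$ with $\nu\ne0$, $B_{IIa}^{+}(\nu)$ with $\nu>0$, $B_{IIa}^{-}(\nu)$ with $\nu<0$, or $B_{IIb}(\xi,\nu)$ with $\xi,\nu\neq0$ and $\nu^2\ge\xi^2$, together with finitely many (possibly no) blocks $B(\nu_j)$, $\nu_j\neq0$, and a zero block (of length $l\ge0$). -/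

import Mathlib

namespace PseudoEuclid

/-- The sign of the `i`-th standard basis vector of `ℝ^{2,n-2}`: the first two are timelike. -/
def eps {n : ℕ} (i : Fin n) : ℝ := if i.val < 2 then -1 else 1

/-- The standard inner product of signature `(2, n-2)` on `ℝⁿ` (for `2 ≤ n`):
`-x₀y₀ - x₁y₁ + x₂y₂ + ⋯ + xₙ₋₁yₙ₋₁`. -/
def inn (n : ℕ) : LinearMap.BilinForm ℝ (Fin n → ℝ) :=
  LinearMap.mk₂ ℝ (fun x y => ∑ i, eps i * (x i * y i))
    (fun x x' y => by
      rw [← Finset.sum_add_distrib]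
      exact Finset.sum_congr rfl fun i _ => by simp only [Pi.add_apply]; ring)
    (fun c x y => by
      rw [smul_eq_mul, Finset.mul_sum]
      exact Finset.sum_congr rfl fun i _ => by simp only [Pi.smul_apply, smul_eq_mul]; ring)
    (fun x y y' => by
      rw [← Finset.sum_add_distrib]
      exact Finset.sum_congr rfl fun i _ => by simp only [Pi.add_apply]; ring)
    (fun c x y => by
      rw [smul_eq_mul, Finset.mul_sum]
      exact Finset.sum_congr rfl fun i _ => by simp only [Pi.smul_apply, smul_eq_mul]; ring)

/-- The musical isomorphism from covectors to vectors; see `inn_sharp`. -/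
def sharp (n : ℕ) : Module.Dual ℝ (Fin n → ℝ) →ₗ[ℝ] (Fin n → ℝ) where
  toFun α := fun i => eps i * α (Pi.single i 1)
  map_add' α β := by
    funext i
    simp only [LinearMap.add_apply, Pi.add_apply]
    ring
  map_smul' c α := by
    funext i
    simp only [LinearMap.smul_apply, Pi.smul_apply, smul_eq_mul, RingHom.id_apply]
    ring

/-- `sharp α` is the vector that represents the covector `α` through the inner product. -/
theorem inn_sharp {n : ℕ} (α : Module.Dual ℝ (Fin n → ℝ)) (x : Fin n → ℝ) :
    inn n (sharp n α) x = α x := by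
  have hx : α x = ∑ i, x i * α (Pi.single i 1) := by
    conv_lhs => rw [pi_eq_sum_univ' x]
    rw [map_sum]
    refine Finset.sum_congr rfl fun i _ => ?_
    rw [map_smul, smul_eq_mul]
  rw [hx]
  change ∑ i, eps i * (eps i * α (Pi.single i 1) * x i) = _
  refine Finset.sum_congr rfl fun i _ => ?_
  have h : eps i * eps i = 1 := by unfold eps; split <;> norm_num
  linear_combination (α (Pi.single i 1) * x i) * h

/-- Timelike vectors. -/
def IsTimelike {n : ℕ} (v : Fin n → ℝ) : Prop := inn n v v < 0

/-- Lightlike vectors: nonzero null vectors. -/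
def IsLightlike {n : ℕ} (v : Fin n → ℝ) : Prop := v ≠ 0 ∧ inn n v v = 0

/-- Causal vectors: `⟨v, v⟩ ≤ 0`. -/
def IsCausal {n : ℕ} (v : Fin n → ℝ) : Prop := inn n v v ≤ 0

/-- A covector is timelike if its dual vector is, that is, if its square with respect to the
induced inner product on covectors is negative. -/
def CovTimelike {n : ℕ} (α : Module.Dual ℝ (Fin n → ℝ)) : Prop := IsTimelike (sharp n α)

/-- A covector is lightlike if its dual vector is. -/
def CovLightlike {n : ℕ} (α : Module.Dual ℝ (Fin n → ℝ)) : Prop := IsLightlike (sharp n α)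

/-- A covector is causal if its dual vector is. -/
def CovCausal {n : ℕ} (α : Module.Dual ℝ (Fin n → ℝ)) : Prop := IsCausal (sharp n α)

/-- The interior product of a vector with a bilinear form (in particular with a 2-form). -/
def interior {n : ℕ} (T : Fin n → ℝ) (ω : LinearMap.BilinForm ℝ (Fin n → ℝ)) :
    Module.Dual ℝ (Fin n → ℝ) := ω T

/-- The endomorphism `b` that corresponds to `ω`, given by `⟨b X, Y⟩ = ω (X, Y)`;
it is skew-adjoint if `ω` is a 2-form. -/
def endo {n : ℕ} (ω : LinearMap.BilinForm ℝ (Fin n → ℝ)) : (Fin n → ℝ) →ₗ[ℝ] (Fin n → ℝ) :=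
  sharp n ∘ₗ ω

theorem inn_endo {n : ℕ} (ω : LinearMap.BilinForm ℝ (Fin n → ℝ)) (x y : Fin n → ℝ) :
    inn n (endo ω x) y = ω x y :=
  inn_sharp (ω x) y

/-- A building block of a normal form: the Gram matrix `gram` of the inner product and the
matrix `op` of the endomorphism with respect to a basis of length `size`
(the `j`-th column of `op` holds the image of the `j`-th basis vector). -/
structure Block where
  size : ℕ
  gram : Matrix (Fin size) (Fin size) ℝ
  op : Matrix (Fin size) (Fin size) ℝ

/-- The Euclidean zero block of length one, signature `(0,1)`. -/
def blockZero : Block := ⟨1, !![1], !![0]⟩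

/-- The Euclidean block `B(ν)`, signature `(0,2)`. -/
def blockB (ν : ℝ) : Block := ⟨2, !![1, 0; 0, 1], !![0, -ν; ν, 0]⟩

/-- The block `B_{Ia}`, signature `(2,2)`. -/
def blockIa : Block :=
  ⟨4, !![0, 0, 0, -1; 0, 0, 1, 0; 0, 1, 0, 0; -1, 0, 0, 0],
    !![0, 0, 1, 0; 0, 0, 0, 1; 0, 0, 0, 0; 0, 0, 0, 0]⟩

/-- The block `B_{Ib}`, signature `(2,1)`. -/
def blockIb : Block :=
  ⟨3, !![0, 0, 1; 0, -1, 0; 1, 0, 0], !![0, 1, 0; 0, 0, 1; 0, 0, 0]⟩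

/-- The block `B_{II}(ν)`, signature `(2,0)`. -/
def blockII (ν : ℝ) : Block := ⟨2, !![-1, 0; 0, -1], !![0, -ν; ν, 0]⟩

/-- The block `B^+_{IIa}` with parameter `ν`, signature `(2,2)`. -/
def blockIIaPlus (ν : ℝ) : Block :=
  ⟨4, !![0, 0, 0, -1; 0, 0, 1, 0; 0, 1, 0, 0; -1, 0, 0, 0],
    !![0, -ν, 1, 0; ν, 0, 0, 1; 0, 0, 0, -ν; 0, 0, ν, 0]⟩

/-- The block `B^-_{IIa}` with parameter `ν`: same operator matrix, opposite inner product. -/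
def blockIIaMinus (ν : ℝ) : Block :=
  ⟨4, !![0, 0, 0, 1; 0, 0, -1, 0; 0, -1, 0, 0; 1, 0, 0, 0],
    !![0, -ν, 1, 0; ν, 0, 0, 1; 0, 0, 0, -ν; 0, 0, ν, 0]⟩

/-- The block `B_{IIb}` with parameters `ξ` and `ν`, signature `(2,2)`. -/
def blockIIb (ξ ν : ℝ) : Block :=
  ⟨4, !![0, 0, 1, 0; 0, 0, 0, -1; 1, 0, 0, 0; 0, -1, 0, 0],
    !![ξ, -ν, 0, 0; ν, ξ, 0, 0; 0, 0, -ξ, ν; 0, 0, -ν, -ξ]⟩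

/-- `ω` has the normal form composed of the finite family `L` of blocks: there is an adapted
basis, with respect to which the inner product and the endomorphism `b` belonging to `ω` both
are block diagonal, the blocks being those of `L`. So the space is the orthogonal direct sum of
the spans of the parts of the basis, and these are preserved by `b`. -/
def HasNormalForm {n : ℕ} (ω : LinearMap.BilinForm ℝ (Fin n → ℝ)) {ι : Type} [Fintype ι]
    [DecidableEq ι] (L : ι → Block) : Prop :=
  ∃ e : Module.Basis (Σ i, Fin (L i).size) ℝ (Fin n → ℝ),
    (∀ p q, inn n (e p) (e q) = Matrix.blockDiagonal' (fun i => (L i).gram) p q) ∧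
    LinearMap.toMatrix e e (endo ω) = Matrix.blockDiagonal' (fun i => (L i).op)

/-- The composition of one block `P` with `k` Euclidean blocks `B(ν₁), …, B(ν_k)` and an Euclidean
zero block of length `l`; `k` and `l` may be zero. -/
def composition (P : Block) {k : ℕ} (ν : Fin k → ℝ) (l : ℕ) : Unit ⊕ Fin k ⊕ Fin l → Block :=
  Sum.elim (fun _ => P) (Sum.elim (fun j => blockB (ν j)) (fun _ => blockZero))

end PseudoEuclid

namespace PseudoEuclid

open Filter Topology

/-! ### Two quadratic forms, one nonpositive where the other is negative. -/

section SProcedure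

variable {V : Type*} [AddCommGroup V] [Module ℝ V] {Q H : LinearMap.BilinForm ℝ V}

/-! Write `Q` for the inner product and `H x y = ⟨b x, b y⟩` (`endoForm`). The causality hypothesis
says that `H ≤ 0` wherever `Q < 0`, and the S-procedure turns this into a global inequality `H ≤ m
Q` with `m ≥ 0`. The largest such `m` is attained at a nonzero vector with `Q ≤ 0`
(`exists_optimal_multiplier`).

If some timelike `T` has a lightlike image `u = b T`, then `H ≤ 0` everywhere and `T` lies in the
radical of `H`. So the image of `b` is orthogonal to `u` and contains no spacelike vector, which in
signature `(2, n-2)` forces `b` to be a wedge `u ∧ w` with `w` causal (`exists_wedge_of_lightlike`).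
A null `w` gives `B_{Ia}`, a timelike one `B_{Ib}`.

If all images are timelike, put `m = ν²` and `C = b² + ν²`. This is self-adjoint and positive
semidefinite, and its kernel contains a nonzero causal vector `x`. A timelike vector in the kernel
spans with its image a block `B_{II}(ν)`. Otherwise `x` is null and orthogonal to `ker C`, so `x = C
y` with `C² y = 0` and `⟨C y, y⟩ > 0`, and `y` generates a block `B_{IIa}^+(ν)`. These two
alternatives already suffice.

Each block contains a negative definite plane, so its orthogonal complement is positive definite and
`b`-invariant. Diagonalizing `b²` there yields the Euclidean blocks
(`exists_hasNormalForm_of_block`). -/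

theorem apply_add_smul_self (hQ : ∀ x y, Q x y = Q y x) (x y : V) (t : ℝ) :
    Q (x + t • y) (x + t • y) = Q x x + 2 * t * Q x y + t ^ 2 * Q y y := by
  simp only [map_add, map_smul, LinearMap.add_apply, LinearMap.smul_apply, smul_eq_mul, hQ y x]
  ring

/-- A null vector is a limit of negative ones: `y + s T` with `s → 0⁺`, once the sign of `T` makes
the cross term nonpositive. -/
theorem apply_self_nonpos_of_null (hQ : ∀ x y, Q x y = Q y x) (hH : ∀ x y, H x y = H y x)
    (h : ∀ x, Q x x < 0 → H x x ≤ 0) {T : V} (hT : Q T T < 0) {y : V} (hy : Q y y = 0) :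
    H y y ≤ 0 := by
  wlog hyT : Q y T ≤ 0 generalizing T
  · refine this (T := -T) (by simpa using hT) ?_
    rw [map_neg]
    linarith
  have hs : ∀ s : ℝ, 0 < s → H y y + 2 * s * H y T + s ^ 2 * H T T ≤ 0 := by
    intro s hs
    rw [← apply_add_smul_self hH]
    apply h
    rw [apply_add_smul_self hQ, hy]
    have h1 : s * Q y T ≤ 0 := mul_nonpos_of_nonneg_of_nonpos hs.le hyT
    have h2 : s ^ 2 * Q T T < 0 := mul_neg_of_pos_of_neg (by positivity) hT
    linarith
  have hlim : Tendsto (fun s : ℝ => H y y + 2 * s * H y T + s ^ 2 * H T T) (𝓝[>] 0)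
      (𝓝 (H y y)) := by
    have hc : Continuous (fun s : ℝ => H y y + 2 * s * H y T + s ^ 2 * H T T) := by fun_prop
    have := hc.tendsto 0
    simp only [mul_zero, zero_mul, add_zero, ne_eq, OfNat.ofNat_ne_zero, not_false_eq_true,
      zero_pow] at this
    exact this.mono_left nhdsWithin_le_nhds
  refine le_of_tendsto hlim ?_
  filter_upwards [self_mem_nhdsWithin] with s h0 using hs s h0

/-- The line `x + t y` meets the null cone of `Q` at one negative and one positive `t`. There `H ≤
0`, and a positive combination of the two inequalities eliminates the mixed term `H x y`. -/
theorem apply_self_mul_le_of_neg_of_pos (hQ : ∀ x y, Q x y = Q y x) (hH : ∀ x y, H x y = H y x)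
    (h : ∀ x, Q x x < 0 → H x x ≤ 0) {x y : V} (hx : Q x x < 0) (hy : 0 < Q y y) :
    H x x * Q y y ≤ Q x x * H y y := by
  have hroot : ∀ t : ℝ, Q x x + 2 * t * Q x y + t ^ 2 * Q y y = 0 →
      H x x + 2 * t * H x y + t ^ 2 * H y y ≤ 0 := by
    intro t ht
    rw [← apply_add_smul_self hH]
    exact apply_self_nonpos_of_null hQ hH h hx (by rw [apply_add_smul_self hQ, ht])
  set α := Q y y
  set β := Q x y
  set γ := Q x x
  have hD : 0 < β ^ 2 - α * γ := by nlinarith [sq_nonneg β, mul_pos hy (neg_pos.2 hx)]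
  obtain ⟨D, hD0, hD2⟩ : ∃ D : ℝ, 0 < D ∧ D ^ 2 = β ^ 2 - α * γ :=
    ⟨√(β ^ 2 - α * γ), Real.sqrt_pos.2 hD, Real.sq_sqrt hD.le⟩
  have h1 := hroot ((-β - D) / α) (by field_simp; linear_combination hD2)
  have h2 := hroot ((-β + D) / α) (by field_simp; linear_combination hD2)
  have hb : β ^ 2 < D ^ 2 := by nlinarith [mul_pos hy (neg_pos.2 hx)]
  have hab := abs_lt_of_sq_lt_sq hb hD0.le
  -- Each root is weighted by `α` times the absolute value of the other, which cancels the terms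
  -- linear in `t`.
  have h3 := mul_nonpos_of_nonneg_of_nonpos (show 0 ≤ -β + D by linarith [(abs_lt.1 hab).2]) h1
  have h4 := mul_nonpos_of_nonneg_of_nonpos (show 0 ≤ β + D by linarith [(abs_lt.1 hab).1]) h2
  have h5 : (2 * D) * (H x x * α - γ * H y y) = α * ((-β + D) *
      (H x x + 2 * ((-β - D) / α) * H x y + ((-β - D) / α) ^ 2 * H y y) + (β + D) *
      (H x x + 2 * ((-β + D) / α) * H x y + ((-β + D) / α) ^ 2 * H y y)) := by
    field_simp
    linear_combination (-2 * D * H y y) * hD2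
  have h6 : (2 * D) * (H x x * α - γ * H y y) ≤ 0 := by
    rw [h5]
    exact mul_nonpos_of_nonneg_of_nonpos hy.le (by linarith)
  have := nonpos_of_mul_nonpos_right h6 (by positivity)
  linarith

/-- The multiplier is the infimum of `H x x / Q x x` over negative `x`. On positive vectors the
bound is the two-vector inequality above, on null vectors the limit argument. -/
theorem exists_multiplier (hQ : ∀ x y, Q x y = Q y x) (hH : ∀ x y, H x y = H y x)
    (h : ∀ x, Q x x < 0 → H x x ≤ 0) {T : V} (hT : Q T T < 0) :
    ∃ μ : ℝ, 0 ≤ μ ∧ (∀ x, H x x ≤ μ * Q x x) ∧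
      ∀ ν, (∀ x, Q x x < 0 → H x x ≤ ν * Q x x) → ν ≤ μ := by
  let S : Set ℝ := (fun x => H x x / Q x x) '' {x | Q x x < 0}
  have hne : S.Nonempty := ⟨_, T, hT, rfl⟩
  have h0 : ∀ r ∈ S, 0 ≤ r := by
    rintro _ ⟨x, hx, rfl⟩
    exact div_nonneg_of_nonpos (h x hx) (le_of_lt hx)
  have hbdd : BddBelow S := ⟨0, h0⟩
  refine ⟨sInf S, le_csInf hne h0, fun x => ?_, fun ν hν => ?_⟩
  · rcases lt_trichotomy (Q x x) 0 with hx | hx | hx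
    · exact (le_div_iff_of_neg hx).1 (csInf_le hbdd ⟨x, hx, rfl⟩)
    · rw [hx, mul_zero]
      exact apply_self_nonpos_of_null hQ hH h hT hx
    · rw [← div_le_iff₀ hx]
      refine le_csInf hne ?_
      rintro _ ⟨y, hy, rfl⟩
      have hy' : Q y y < 0 := hy
      rw [le_div_iff_of_neg hy', div_mul_eq_mul_div, le_div_iff₀ hx]
      linarith [apply_self_mul_le_of_neg_of_pos hQ hH h hy' hx]
  · refine le_csInf hne ?_
    rintro _ ⟨y, hy, rfl⟩
    exact (le_div_iff_of_neg hy).2 (hν y hy)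

end SProcedure

theorem continuous_apply_self {n : ℕ} (Q : LinearMap.BilinForm ℝ (Fin n → ℝ)) :
    Continuous fun x => Q x x := by
  have : (fun x => Q x x) = fun x : Fin n → ℝ => ∑ i, x i * Q (Pi.single i 1) x := by
    funext x
    have hx : Q x = ∑ i, x i • Q (Pi.single i 1) := by
      conv_lhs => rw [pi_eq_sum_univ' x, map_sum]
      simp only [map_smul]
    simp [congrArg (fun φ => φ x) hx]
  rw [this]
  exact continuous_finsetSum _ fun i _ =>
    (continuous_apply i).mul (LinearMap.continuous_of_finiteDimensional _)

/-- The optimal multiplier of the S-procedure is attained at a non-spacelike vector. -/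
theorem exists_optimal_multiplier {n : ℕ} {Q H : LinearMap.BilinForm ℝ (Fin n → ℝ)}
    (hQ : ∀ x y, Q x y = Q y x) (hH : ∀ x y, H x y = H y x)
    (h : ∀ x, Q x x < 0 → H x x ≤ 0) {T : Fin n → ℝ} (hT : Q T T < 0) :
    ∃ μ : ℝ, 0 ≤ μ ∧ (∀ x, H x x ≤ μ * Q x x) ∧
      ∃ x, x ≠ 0 ∧ Q x x ≤ 0 ∧ H x x = μ * Q x x := by
  obtain ⟨μ, h0, hle, hmax⟩ := exists_multiplier hQ hH h hT
  refine ⟨μ, h0, hle, ?_⟩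
  have hQc := continuous_apply_self Q
  have hHc := continuous_apply_self H
  let K : Set (Fin n → ℝ) := Metric.sphere 0 1 ∩ {x | Q x x ≤ 0}
  have hK : IsCompact K := (isCompact_sphere 0 1).inter_right (isClosed_le hQc continuous_const)
  have hscale : ∀ x, Q x x < 0 → ∃ c : ℝ, 0 < c ∧ c • x ∈ K := by
    intro x hx
    have hx0 : x ≠ 0 := by rintro rfl; simp at hx
    refine ⟨‖x‖⁻¹, by positivity, ?_, ?_⟩
    · simp [norm_smul, hx0]
    · have : 0 ≤ ‖x‖⁻¹ * ‖x‖⁻¹ := by positivity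
      simp only [Set.mem_ofPred_eq, map_smul, LinearMap.smul_apply, smul_eq_mul]
      rw [← mul_assoc]
      exact mul_nonpos_of_nonneg_of_nonpos this hx.le
  obtain ⟨c, -, hc⟩ := hscale T hT
  obtain ⟨x, hxK, hx⟩ := hK.exists_isMinOn ⟨_, hc⟩
    (f := fun x => μ * Q x x - H x x) (by fun_prop)
  obtain ⟨z, hzK, hz⟩ := hK.exists_isMinOn ⟨_, hc⟩ (f := fun x => Q x x) (by fun_prop)
  refine ⟨x, ?_, hxK.2, ?_⟩
  · rintro rfl
    simpa using hxK.1
  by_contra hne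
  -- A positive gap `m` on the compact set `K`, where `-Q ≤ M`, would leave room for the larger
  -- multiplier `μ + m / M`. The summand `1` only keeps `M` positive.
  set m := μ * Q x x - H x x with hm
  have hmpos : 0 < m := lt_of_le_of_ne (by linarith [hle x]) fun h0 => hne (by linarith)
  set M := 1 - Q z z with hM
  have hz0 : Q z z ≤ 0 := hzK.2
  have hMpos : 0 < M := by linarith
  have hbig : μ + m / M ≤ μ := by
    refine hmax _ fun y hy => ?_
    obtain ⟨c, hc, hcK⟩ := hscale y hy
    have h1 : m ≤ μ * Q (c • y) (c • y) - H (c • y) (c • y) := hx hcK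
    have h2 : Q z z ≤ Q (c • y) (c • y) := hz hcK
    have h3 : -(m / M) * Q (c • y) (c • y) ≤ m := by
      have h4 : -Q (c • y) (c • y) ≤ M := by linarith
      calc -(m / M) * Q (c • y) (c • y) = (m / M) * (-Q (c • y) (c • y)) := by ring
        _ ≤ (m / M) * M := by gcongr
        _ = m := by field_simp
    simp only [map_smul, LinearMap.smul_apply, smul_eq_mul] at h1 h3
    have h5 : 0 ≤ c * c * ((μ + m / M) * Q y y - H y y) := by linarith
    have := nonneg_of_mul_nonneg_right h5 (by positivity)
    linarith
  have : 0 < m / M := by positivity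
  linarith

/-- The form `B` itself serves as an inner product, for which the spectral theorem applies. -/
theorem exists_eigenvector_of_posDef {E : Type*} [AddCommGroup E] [Module ℝ E]
    [FiniteDimensional ℝ E] [Nontrivial E] {B : LinearMap.BilinForm ℝ E}
    (hB : ∀ x y, B x y = B y x) (hpos : ∀ x, x ≠ 0 → 0 < B x x) (A : E →ₗ[ℝ] E)
    (hA : ∀ x y, B (A x) y = B x (A y)) : ∃ x, x ≠ 0 ∧ ∃ c : ℝ, A x = c • x := by
  let core : InnerProductSpace.Core ℝ E :=
    { inner := fun x y => B x y
      conj_inner_symm := fun x y => by simp [hB y x]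
      re_inner_nonneg := fun x => by
        by_cases hx : x = 0
        · simp [hx]
        · exact (hpos x hx).le
      add_left := fun x y z => by simp
      smul_left := fun x y r => by simp
      definite := fun x hx => by
        by_contra h
        exact (hpos x h).ne' hx }
  let _ : NormedAddCommGroup E := core.toNormedAddCommGroup
  let _ : InnerProductSpace ℝ E := InnerProductSpace.ofCore core.toCore
  have hsymm : A.IsSymmetric := fun x y => hA x y
  by_contra! h
  refine not_subsingleton E (hsymm.subsingleton_of_no_eigenvalue_finiteDimensional fun c => ?_)
  rw [Submodule.eq_bot_iff]
  intro x hx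
  by_contra hx0
  exact h x hx0 c (Module.End.mem_eigenspace_iff.1 hx)

/-! ### Geometry of signature `(2, n-2)`. -/

section Geometry

variable {n : ℕ}

theorem inn_apply (x y : Fin n → ℝ) : inn n x y = ∑ i, eps i * (x i * y i) := rfl

theorem inn_comm (x y : Fin n → ℝ) : inn n x y = inn n y x := by
  simp only [inn_apply, mul_comm (x _)]

theorem inn_single (x : Fin n → ℝ) (i : Fin n) : inn n x (Pi.single i 1) = eps i * x i := by
  rw [inn_apply, Finset.sum_eq_single i] <;> simp +contextual

theorem eq_zero_of_inn_eq_zero {x : Fin n → ℝ} (h : ∀ y, inn n x y = 0) : x = 0 := by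
  funext i
  have := h (Pi.single i 1)
  rw [inn_single] at this
  have he : (eps i : ℝ) ≠ 0 := by unfold eps; split <;> norm_num
  simpa [he] using this

theorem inn_nondegenerate : (inn n).Nondegenerate :=
  ⟨fun _ h => eq_zero_of_inn_eq_zero h,
    fun _ h => eq_zero_of_inn_eq_zero fun y => (inn_comm _ _).trans (h y)⟩

theorem inn_isRefl : (inn n).IsRefl := fun x y h => by rw [inn_comm, h]

theorem exists_inn_eq_one {u : Fin n → ℝ} (hu : u ≠ 0) : ∃ z, inn n u z = 1 := by
  obtain ⟨y, hy⟩ : ∃ y, inn n u y ≠ 0 := by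
    by_contra! h
    exact hu (eq_zero_of_inn_eq_zero h)
  exact ⟨(inn n u y)⁻¹ • y, by simp [hy]⟩

/-- The orthogonal complement of a negative definite plane is positive definite. -/
theorem inn_self_pos_of_orthogonal (hn : 2 ≤ n) {p q x : Fin n → ℝ} (hp : inn n p p < 0)
    (hq : inn n q q < 0) (hpq : inn n p q = 0) (hpx : inn n p x = 0) (hqx : inn n q x = 0)
    (hx : x ≠ 0) : 0 < inn n x x := by
  by_contra! hxx
  let i₀ : Fin n := ⟨0, by omega⟩
  let i₁ : Fin n := ⟨1, by omega⟩
  -- Three coefficients against two timelike coordinates: some nontrivial combination of `p, q, x`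
  -- has both coordinates zero, so its square is nonnegative, while orthogonality makes it
  -- nonpositive.
  let f : (Fin 3 → ℝ) →ₗ[ℝ] (Fin 2 → ℝ) :=
    LinearMap.pi ![LinearMap.proj i₀, LinearMap.proj i₁] ∘ₗ Fintype.linearCombination ℝ ![p, q, x]
  have hker : LinearMap.ker f ≠ ⊥ := LinearMap.ker_ne_bot_of_finrank_lt (by simp)
  obtain ⟨a, haf, ha⟩ := Submodule.exists_mem_ne_zero_of_ne_bot hker
  set v : Fin n → ℝ := a 0 • p + a 1 • q + a 2 • x with hv
  have hlc : Fintype.linearCombination ℝ ![p, q, x] a = v := by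
    simp [Fintype.linearCombination_apply, Fin.sum_univ_three, hv]
  have hf : f a = ![v i₀, v i₁] := by
    funext j
    fin_cases j <;> simp [f, hlc]
  rw [LinearMap.mem_ker, hf] at haf
  have h0 : v i₀ = 0 := by simpa using congrFun haf 0
  have h1 : v i₁ = 0 := by simpa using congrFun haf 1
  have hvv : inn n v v = a 0 ^ 2 * inn n p p + a 1 ^ 2 * inn n q q + a 2 ^ 2 * inn n x x := by
    simp only [hv, map_add, map_smul, LinearMap.add_apply, LinearMap.smul_apply, smul_eq_mul, hpq,
      hpx, hqx, inn_comm q p, inn_comm x p, inn_comm x q]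
    ring
  have hterm : ∀ i, 0 ≤ eps i * (v i * v i) := by
    intro i
    by_cases hi : i.val < 2
    · have : i = i₀ ∨ i = i₁ := by simp only [Fin.ext_iff, i₀, i₁]; omega
      rcases this with rfl | rfl <;> simp [h0, h1]
    · simp only [eps, hi, if_false, one_mul]
      exact mul_self_nonneg _
  have hnn : 0 ≤ inn n v v := by
    rw [inn_apply]
    exact Finset.sum_nonneg fun i _ => hterm i
  have e0 : 0 ≤ -(a 0 ^ 2 * inn n p p) := by nlinarith [sq_nonneg (a 0)]
  have e1 : 0 ≤ -(a 1 ^ 2 * inn n q q) := by nlinarith [sq_nonneg (a 1)]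
  have e2 : 0 ≤ -(a 2 ^ 2 * inn n x x) := by nlinarith [sq_nonneg (a 2)]
  have ha0 : a 0 = 0 := by
    have : a 0 ^ 2 * inn n p p = 0 := by linarith
    simpa [hp.ne] using this
  have ha1 : a 1 = 0 := by
    have : a 1 ^ 2 * inn n q q = 0 := by linarith
    simpa [hq.ne] using this
  have hv0 : v = 0 := by
    have hsum : inn n v v = 0 := by linarith
    rw [inn_apply] at hsum
    funext i
    have := (Finset.sum_eq_zero_iff_of_nonneg fun i _ => hterm i).1 hsum i (Finset.mem_univ i)
    have he : (eps i : ℝ) ≠ 0 := by unfold eps; split <;> norm_num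
    simpa [he] using this
  have ha2 : a 2 = 0 := by
    rw [hv, ha0, ha1] at hv0
    simpa [hx] using hv0
  exact ha (by funext j; fin_cases j <;> simp [ha0, ha1, ha2])

theorem exists_timelike (hn : 2 ≤ n) : ∃ T : Fin n → ℝ, inn n T T < 0 :=
  ⟨Pi.single ⟨0, by omega⟩ 1, by rw [inn_single]; simp [eps]⟩

theorem inn_endo_left {ω : LinearMap.BilinForm ℝ (Fin n → ℝ)} (hω : ω.IsAlt)
    (x y : Fin n → ℝ) : inn n (endo ω x) y = -inn n x (endo ω y) := by
  rw [inn_comm x, inn_endo, inn_endo, hω.neg_eq]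

/-- A self-adjoint endomorphism that preserves a nontrivial positive definite subspace has an
eigenvector there. -/
theorem exists_eigenvector (M : Submodule ℝ (Fin n → ℝ)) (hM : M ≠ ⊥)
    (hpos : ∀ x ∈ M, x ≠ 0 → 0 < inn n x x) (A : (Fin n → ℝ) →ₗ[ℝ] (Fin n → ℝ))
    (hA : ∀ x y, inn n (A x) y = inn n x (A y)) (hAM : ∀ x ∈ M, A x ∈ M) :
    ∃ x ∈ M, x ≠ 0 ∧ ∃ c : ℝ, A x = c • x := by
  have := (Submodule.nontrivial_iff_ne_bot).2 hM
  obtain ⟨x, hx, c, hc⟩ := exists_eigenvector_of_posDef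
    (B := (inn n).compl₁₂ M.subtype M.subtype) (fun x y => inn_comm _ _)
    (fun x hx => hpos x x.2 (by simpa using hx)) (A.restrict hAM) (fun x y => hA x y)
  exact ⟨x, x.2, by simpa using hx, c, congrArg Subtype.val hc⟩

end Geometry

/-! ### Adapted families of vectors and their enlargement. -/

section Adapted

variable {n : ℕ}

/-- A family of vectors, arranged in blocks, in which the inner product and the endomorphism of
`ω` have the block diagonal shape prescribed by `L`. -/
structure IsAdapted (ω : LinearMap.BilinForm ℝ (Fin n → ℝ)) {ι : Type} (L : ι → Block)
    (e : ∀ i, Fin (L i).size → (Fin n → ℝ)) : Prop where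
  gram : ∀ i a c, inn n (e i a) (e i c) = (L i).gram a c
  orthogonal : ∀ i j, i ≠ j → ∀ a c, inn n (e i a) (e j c) = 0
  op : ∀ i a, endo ω (e i a) = ∑ c, (L i).op c a • e i c

variable {ω : LinearMap.BilinForm ℝ (Fin n → ℝ)}

/-- Pairing a linear relation with the vectors of block `j` isolates its coefficients there,
multiplied by an invertible Gram matrix. -/
theorem IsAdapted.linearIndependent {ι : Type} [Fintype ι] [DecidableEq ι] {L : ι → Block}
    {e : ∀ i, Fin (L i).size → (Fin n → ℝ)} (he : IsAdapted ω L e)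
    (hL : ∀ i, (L i).gram.det ≠ 0) :
    LinearIndependent ℝ (fun p : Σ i, Fin (L i).size => e p.1 p.2) := by
  rw [Fintype.linearIndependent_iff]
  rintro g hg ⟨j, a⟩
  suffices h : (fun a => g ⟨j, a⟩) = 0 from congrFun h a
  refine Matrix.eq_zero_of_vecMul_eq_zero (hL j) ?_
  funext c
  have h := congrArg (fun v => inn n v (e j c)) hg
  simp only [map_sum, LinearMap.sum_apply, map_smul, LinearMap.smul_apply, smul_eq_mul, map_zero,
    LinearMap.zero_apply, Fintype.sum_sigma] at h
  rw [Finset.sum_eq_single j] at h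
  · simpa [Matrix.vecMul, dotProduct, he.gram] using h
  · intro i _ hij
    exact Finset.sum_eq_zero fun a _ => by rw [he.orthogonal i j hij, mul_zero]
  · simp

/-- Only spanning remains, and by nondegeneracy a subspace with zero orthogonal complement is
everything. -/
theorem IsAdapted.hasNormalForm {ι : Type} [Fintype ι] [DecidableEq ι] {L : ι → Block}
    {e : ∀ i, Fin (L i).size → (Fin n → ℝ)} (he : IsAdapted ω L e)
    (hL : ∀ i, (L i).gram.det ≠ 0) (htot : ∀ x, (∀ i a, inn n (e i a) x = 0) → x = 0) :
    HasNormalForm ω L := by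
  have hli := he.linearIndependent hL
  set f : (Σ i, Fin (L i).size) → (Fin n → ℝ) := fun p => e p.1 p.2 with hf
  have hspan : ⊤ ≤ Submodule.span ℝ (Set.range f) := by
    have hbot : (inn n).orthogonal (Submodule.span ℝ (Set.range f)) = ⊥ := by
      rw [Submodule.eq_bot_iff]
      intro x hx
      refine htot x fun i a => ?_
      exact hx (e i a) (Submodule.subset_span ⟨⟨i, a⟩, rfl⟩)
    rw [← LinearMap.BilinForm.orthogonal_orthogonal inn_nondegenerate inn_isRefl
      (Submodule.span ℝ (Set.range f)), hbot]
    intro x _ y hy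
    rw [Submodule.mem_bot] at hy
    simp [hy]
  refine ⟨Module.Basis.mk hli hspan, ?_, ?_⟩
  · rintro ⟨i, a⟩ ⟨j, c⟩
    simp only [Module.Basis.mk_apply, hf]
    by_cases hij : i = j
    · subst hij
      rw [Matrix.blockDiagonal'_apply_eq, he.gram]
    · rw [Matrix.blockDiagonal'_apply_ne _ _ _ hij, he.orthogonal i j hij]
  · symm
    rw [← LinearMap.toMatrix_toLin (Module.Basis.mk hli hspan) (Module.Basis.mk hli hspan)
      (Matrix.blockDiagonal' fun i => (L i).op)]
    congr 1
    refine (Module.Basis.mk hli hspan).ext ?_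
    rintro ⟨i, a⟩
    rw [Matrix.toLin_self, Fintype.sum_sigma, Finset.sum_eq_single i]
    · simp [Module.Basis.mk_apply, hf, he.op]
    · intro j _ hj
      exact Finset.sum_eq_zero fun c _ => by
        rw [Matrix.blockDiagonal'_apply_ne _ _ _ hj, zero_smul]
    · simp

theorem IsAdapted.inn_endo_eq_zero (hω : ω.IsAlt) {ι : Type} {L : ι → Block}
    {e : ∀ i, Fin (L i).size → (Fin n → ℝ)} (he : IsAdapted ω L e) {x : Fin n → ℝ}
    (hx : ∀ i a, inn n (e i a) x = 0) (i : ι) (a : Fin (L i).size) :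
    inn n (e i a) (endo ω x) = 0 := by
  have : inn n (endo ω (e i a)) x = 0 := by
    rw [he.op]
    simp [hx, LinearMap.sum_apply]
  rw [inn_endo_left hω] at this
  linarith

/-- The data of one more block, added in front of the Euclidean blocks `B(ν)`. -/
def consRotation {P : Block} {k l : ℕ} {μ : Fin k → ℝ} (ν : ℝ)
    (e : ∀ i, Fin (composition P μ l i).size → (Fin n → ℝ)) (x y : Fin n → ℝ) :
    ∀ i, Fin (composition P (Fin.cons ν μ : Fin (k + 1) → ℝ) l i).size → (Fin n → ℝ)
  | .inl u => e (.inl u)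
  | .inr (.inl j) => Fin.cases (motive := fun _ => Fin 2 → (Fin n → ℝ)) ![x, y]
      (fun j => e (.inr (.inl j))) j
  | .inr (.inr j) => e (.inr (.inr j))

/-- The data of one more zero block. -/
def consZero {P : Block} {k l : ℕ} {μ : Fin k → ℝ}
    (e : ∀ i, Fin (composition P μ l i).size → (Fin n → ℝ)) (x : Fin n → ℝ) :
    ∀ i, Fin (composition P μ (l + 1) i).size → (Fin n → ℝ)
  | .inl u => e (.inl u)
  | .inr (.inl j) => e (.inr (.inl j))
  | .inr (.inr j) => Fin.cases (motive := fun _ => Fin 1 → (Fin n → ℝ)) (fun _ => x)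
      (fun j => e (.inr (.inr j))) j

theorem IsAdapted.consZero {P : Block} {k l : ℕ} {μ : Fin k → ℝ}
    {e : ∀ i, Fin (composition P μ l i).size → (Fin n → ℝ)}
    (he : IsAdapted ω (composition P μ l) e) {x : Fin n → ℝ} (hx : ∀ i a, inn n (e i a) x = 0)
    (hxx : inn n x x = 1) (hbx : endo ω x = 0) :
    IsAdapted ω (composition P μ (l + 1)) (consZero e x) where
  gram := by
    rintro (u | j | j)
    · exact he.gram (.inl u)
    · exact he.gram (.inr (.inl j))
    · refine Fin.cases ?_ (fun j => ?_) j
      · change ∀ a c : Fin 1, inn n x x = (!![1] : Matrix (Fin 1) (Fin 1) ℝ) a c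
        intro a c
        simp [Subsingleton.elim a 0, Subsingleton.elim c 0, hxx]
      · exact he.gram (.inr (.inr j))
  orthogonal := by
    have hx' : ∀ i a, inn n x (e i a) = 0 := fun i a => by rw [inn_comm, hx]
    rintro (u | j | j) (u' | j' | j') hne
    · exact (hne rfl).elim
    · exact he.orthogonal (.inl u) (.inr (.inl j')) (by simp)
    · refine Fin.cases ?_ (fun j' => ?_) j'
      · exact fun a c => hx (.inl u) a
      · exact he.orthogonal (.inl u) (.inr (.inr j')) (by simp)
    · exact he.orthogonal (.inr (.inl j)) (.inl u') (by simp)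
    · exact he.orthogonal (.inr (.inl j)) (.inr (.inl j')) (by simpa using hne)
    · refine Fin.cases ?_ (fun j' => ?_) j'
      · exact fun a c => hx (.inr (.inl j)) a
      · exact he.orthogonal (.inr (.inl j)) (.inr (.inr j')) (by simp)
    · refine Fin.cases ?_ (fun j => ?_) j
      · exact fun a c => hx' (.inl u') c
      · exact he.orthogonal (.inr (.inr j)) (.inl u') (by simp)
    · refine Fin.cases ?_ (fun j => ?_) j
      · exact fun a c => hx' (.inr (.inl j')) c
      · exact he.orthogonal (.inr (.inr j)) (.inr (.inl j')) (by simp)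
    · revert hne
      refine Fin.cases ?_ (fun j => ?_) j <;> refine Fin.cases ?_ (fun j' => ?_) j'
      · exact fun h => (h rfl).elim
      · exact fun _ a c => hx' (.inr (.inr j')) c
      · exact fun _ a c => hx (.inr (.inr j)) a
      · exact fun h => he.orthogonal (.inr (.inr j)) (.inr (.inr j')) (by simpa using h)
  op := by
    rintro (u | j | j)
    · exact he.op (.inl u)
    · exact he.op (.inr (.inl j))
    · refine Fin.cases ?_ (fun j => ?_) j
      · change ∀ a : Fin 1, endo ω x = ∑ c : Fin 1, (!![0] : Matrix (Fin 1) (Fin 1) ℝ) c a • x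
        intro a
        simp [Subsingleton.elim a 0, hbx]
      · exact he.op (.inr (.inr j))

theorem IsAdapted.consRotation {P : Block} {k l : ℕ} {μ : Fin k → ℝ}
    {e : ∀ i, Fin (composition P μ l i).size → (Fin n → ℝ)}
    (he : IsAdapted ω (composition P μ l) e) {x y : Fin n → ℝ} {ν : ℝ}
    (hx : ∀ i a, inn n (e i a) x = 0) (hy : ∀ i a, inn n (e i a) y = 0)
    (hxx : inn n x x = 1) (hxy : inn n x y = 0) (hyy : inn n y y = 1)
    (hbx : endo ω x = ν • y) (hby : endo ω y = -ν • x) :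
    IsAdapted ω (composition P (Fin.cons ν μ : Fin (k + 1) → ℝ) l) (consRotation ν e x y) := by
  have hz : ∀ i a (c : Fin 2), inn n (e i a) (![x, y] c) = 0 := by
    intro i a c
    fin_cases c
    · exact hx i a
    · exact hy i a
  have hz' : ∀ i a (c : Fin 2), inn n (![x, y] c) (e i a) = 0 := fun i a c => by
    rw [inn_comm, hz]
  refine ⟨?_, ?_, ?_⟩
  · rintro (u | j | j)
    · exact he.gram (.inl u)
    · refine Fin.cases ?_ (fun j => ?_) j
      · change ∀ a c : Fin 2, inn n (![x, y] a) (![x, y] c) = !![1, 0; 0, 1] a c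
        intro a c
        fin_cases a <;> fin_cases c <;> simp [hxx, hxy, hyy, inn_comm y x]
      · exact he.gram (.inr (.inl j))
    · exact he.gram (.inr (.inr j))
  · rintro (u | j | j) (u' | j' | j') hne
    · exact (hne rfl).elim
    · refine Fin.cases ?_ (fun j' => ?_) j'
      · exact hz (.inl u)
      · exact he.orthogonal (.inl u) (.inr (.inl j')) (by simp)
    · exact he.orthogonal (.inl u) (.inr (.inr j')) (by simp)
    · refine Fin.cases ?_ (fun j => ?_) j
      · exact fun a c => hz' (.inl u') c a
      · exact he.orthogonal (.inr (.inl j)) (.inl u') (by simp)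
    · revert hne
      refine Fin.cases ?_ (fun j => ?_) j <;> refine Fin.cases ?_ (fun j' => ?_) j'
      · exact fun h => (h rfl).elim
      · exact fun _ a c => hz' (.inr (.inl j')) c a
      · exact fun _ => hz (.inr (.inl j))
      · exact fun h => he.orthogonal (.inr (.inl j)) (.inr (.inl j')) (by simpa using h)
    · refine Fin.cases ?_ (fun j => ?_) j
      · exact fun a c => hz' (.inr (.inr j')) c a
      · exact he.orthogonal (.inr (.inl j)) (.inr (.inr j')) (by simp)
    · exact he.orthogonal (.inr (.inr j)) (.inl u') (by simp)
    · refine Fin.cases ?_ (fun j' => ?_) j'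
      · exact hz (.inr (.inr j))
      · exact he.orthogonal (.inr (.inr j)) (.inr (.inl j')) (by simp)
    · exact he.orthogonal (.inr (.inr j)) (.inr (.inr j')) (by simpa using hne)
  · rintro (u | j | j)
    · exact he.op (.inl u)
    · refine Fin.cases ?_ (fun j => ?_) j
      · change ∀ a : Fin 2, endo ω (![x, y] a) =
          ∑ c : Fin 2, (!![0, -ν; ν, 0] : Matrix (Fin 2) (Fin 2) ℝ) c a • ![x, y] c
        intro a
        fin_cases a <;> simp [hbx, hby]
      · exact he.op (.inr (.inl j))
    · exact he.op (.inr (.inr j))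

end Adapted

/-! ### Splitting the positive definite complement into Euclidean blocks. -/

section Completion

variable {n : ℕ} {ω : LinearMap.BilinForm ℝ (Fin n → ℝ)}

theorem composition_gram_det_ne_zero {P : Block} (hP : P.gram.det ≠ 0) {k : ℕ} (μ : Fin k → ℝ)
    (l : ℕ) : ∀ i, (composition P μ l i).gram.det ≠ 0 := by
  rintro (u | j | j)
  · exact hP
  · change (!![1, 0; 0, 1] : Matrix (Fin 2) (Fin 2) ℝ).det ≠ 0
    simp [Matrix.det_fin_two]
  · change (!![1] : Matrix (Fin 1) (Fin 1) ℝ).det ≠ 0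
    simp

theorem IsAdapted.size_le {P : Block} (hP : P.gram.det ≠ 0) {k l : ℕ} {μ : Fin k → ℝ}
    {e : ∀ i, Fin (composition P μ l i).size → (Fin n → ℝ)}
    (he : IsAdapted ω (composition P μ l) e) : P.size + (2 * k + l) ≤ n := by
  have h := (he.linearIndependent (composition_gram_det_ne_zero hP μ l)).fintype_card_le_finrank
  have h2 : ∑ j : Fin k, (blockB (μ j)).size = 2 * k := by simp [blockB, mul_comm]
  have h3 : ∑ j : Fin l, blockZero.size = l := by simp [blockZero]
  have hsum : ∑ i, (composition P μ l i).size ≤ n := by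
    simpa only [Fintype.card_sigma, Fintype.card_fin, Module.finrank_fin_fun] using h
  simpa [composition, h2, h3] using hsum

/-- If the orthogonal complement of the first block is positive definite, an adapted family that
does not exhaust the space can be enlarged. -/
theorem IsAdapted.exists_extension (hω : ω.IsAlt) {P : Block} {k l : ℕ} {μ : Fin k → ℝ}
    {e : ∀ i, Fin (composition P μ l i).size → (Fin n → ℝ)}
    (he : IsAdapted ω (composition P μ l) e)
    (hpos : ∀ x, x ≠ 0 → (∀ a, inn n (e (.inl ()) a) x = 0) → 0 < inn n x x)
    (hne : ∃ x, (∀ i a, inn n (e i a) x = 0) ∧ x ≠ 0) :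
    ∃ x, (∀ i a, inn n (e i a) x = 0) ∧ inn n x x = 1 ∧ (endo ω x = 0 ∨
      ∃ (ν : ℝ) (y : Fin n → ℝ), ν ≠ 0 ∧ (∀ i a, inn n (e i a) y = 0) ∧ inn n x y = 0 ∧
        inn n y y = 1 ∧ endo ω x = ν • y ∧ endo ω y = -ν • x) := by
  let M : Submodule ℝ (Fin n → ℝ) := ⨅ i, ⨅ a, LinearMap.ker (inn n (e i a))
  have hmem : ∀ x, x ∈ M ↔ ∀ i a, inn n (e i a) x = 0 := by simp [M]
  obtain ⟨x₀, hx₀, hx₀0⟩ := hne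
  -- `b` is skew, but `b²` is self-adjoint and preserves `M`. A unit eigenvector `v` is either
  -- killed by `b` or spans a rotation plane with `b v`, with `ν² = -c = ⟨b v, b v⟩`.
  obtain ⟨x, hx, hx0, c, hc⟩ := exists_eigenvector M
    (Submodule.ne_bot_iff M |>.2 ⟨x₀, (hmem x₀).2 hx₀, hx₀0⟩)
    (fun x hx h0 => hpos x h0 fun a => (hmem x).1 hx _ a) (endo ω ∘ₗ endo ω)
    (fun x y => by simp [inn_endo_left hω])
    (fun x hx => (hmem _).2 fun i a => he.inn_endo_eq_zero hω
      (he.inn_endo_eq_zero hω ((hmem x).1 hx)) i a)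
  rw [hmem] at hx
  have hq := hpos x hx0 fun a => hx _ a
  set r := √(inn n x x) with hr
  have hr0 : 0 < r := Real.sqrt_pos.2 hq
  have hr2 : r ^ 2 = inn n x x := Real.sq_sqrt hq.le
  set v := r⁻¹ • x with hv
  have hvv : inn n v v = 1 := by
    simp only [hv, map_smul, LinearMap.smul_apply, smul_eq_mul, ← hr2]
    field_simp
  have hvc : endo ω (endo ω v) = c • v := by
    have : endo ω (endo ω x) = c • x := hc
    rw [hv, map_smul, map_smul, this, smul_comm]
  have hvM : ∀ i a, inn n (e i a) v = 0 := fun i a => by rw [hv, map_smul, hx, smul_zero]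
  have hv0 : v ≠ 0 := by
    intro h
    simp [h] at hvv
  have hbM := fun i a => he.inn_endo_eq_zero hω hvM i a
  refine ⟨v, hvM, hvv, or_iff_not_imp_left.2 fun hb => ?_⟩
  have hbv : inn n (endo ω v) (endo ω v) = -c := by
    rw [inn_endo_left hω, hvc, map_smul, hvv, smul_eq_mul, mul_one]
  have hbpos := hpos _ hb fun a => hbM _ a
  obtain ⟨ν, hν0, hν⟩ : ∃ ν : ℝ, 0 < ν ∧ ν ^ 2 = -c :=
    ⟨√(-c), Real.sqrt_pos.2 (hbv ▸ hbpos), Real.sq_sqrt (hbv ▸ hbpos).le⟩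
  refine ⟨ν, ν⁻¹ • endo ω v, hν0.ne', fun i a => by rw [map_smul, hbM, smul_zero], ?_, ?_, ?_, ?_⟩
  · have h := inn_endo_left hω v v
    rw [inn_comm] at h
    rw [map_smul, show inn n v (endo ω v) = 0 by linarith, smul_zero]
  · simp only [map_smul, LinearMap.smul_apply, smul_eq_mul, hbv, ← hν]
    field_simp
  · rw [smul_inv_smul₀ hν0.ne']
  · rw [map_smul, hvc, smul_smul]
    congr 1
    rw [show c = -ν ^ 2 by linarith]
    field_simp

/-- Induction on a bound `d` for the dimension still missing. The last clause records that no
rotation block is added when `b` vanishes on the complement of the first block. -/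
theorem IsAdapted.exists_hasNormalForm (hω : ω.IsAlt) {P : Block} (hP : P.gram.det ≠ 0) (d : ℕ) :
    ∀ {k l : ℕ} {μ : Fin k → ℝ} {e : ∀ i, Fin (composition P μ l i).size → (Fin n → ℝ)},
    IsAdapted ω (composition P μ l) e → n ≤ P.size + (2 * k + l) + d → (∀ j, μ j ≠ 0) →
    (∀ x, x ≠ 0 → (∀ a, inn n (e (.inl ()) a) x = 0) → 0 < inn n x x) →
    ∃ (k' l' : ℕ) (μ' : Fin k' → ℝ), (∀ j, μ' j ≠ 0) ∧ HasNormalForm ω (composition P μ' l') ∧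
      ((∀ x, (∀ a, inn n (e (.inl ()) a) x = 0) → endo ω x = 0) → k' = k) := by
  induction d using Nat.strong_induction_on with
  | _ d ih =>
  intro k l μ e he hd hμ hpos
  by_cases htot : ∀ x, (∀ i a, inn n (e i a) x = 0) → x = 0
  · exact ⟨k, l, μ, hμ, he.hasNormalForm (composition_gram_det_ne_zero hP μ l) htot, fun _ => rfl⟩
  push Not at htot
  obtain ⟨x, hx, hxx, h | ⟨ν, y, hν, hy, hxy, hyy, hbx, hby⟩⟩ := he.exists_extension hω hpos htot
  · have he' := he.consZero hx hxx h
    have hs := he'.size_le hP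
    have := ih (d - 1) (by omega) he' (by omega) hμ hpos
    exact this
  · have he' := he.consRotation hx hy hxx hxy hyy hbx hby
    have hs := he'.size_le hP
    obtain ⟨k', l', μ', hμ', h', -⟩ := ih (d - 1) (by omega) he' (by omega)
      (Fin.cases (by simpa using hν) (by simpa using hμ)) hpos
    refine ⟨k', l', μ', hμ', h', fun hvan => ?_⟩
    have h0 := hvan x fun a => hx _ a
    rw [hbx, smul_eq_zero_iff_right hν] at h0
    simp [h0] at hyy

/-- A block realised by vectors `p` that contain a negative definite plane in their span splits
off, and the complement decomposes into Euclidean blocks. -/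
theorem exists_hasNormalForm_of_block (hn : 2 ≤ n) (hω : ω.IsAlt) {P : Block}
    (hP : P.gram.det ≠ 0) (p : Fin P.size → (Fin n → ℝ))
    (hgram : ∀ a c, inn n (p a) (p c) = P.gram a c)
    (hop : ∀ a, endo ω (p a) = ∑ c, P.op c a • p c) {q r : Fin n → ℝ}
    (hq : q ∈ Submodule.span ℝ (Set.range p)) (hr : r ∈ Submodule.span ℝ (Set.range p))
    (hqq : inn n q q < 0) (hrr : inn n r r < 0) (hqr : inn n q r = 0) :
    ∃ (k l : ℕ) (μ : Fin k → ℝ), (∀ j, μ j ≠ 0) ∧ HasNormalForm ω (composition P μ l) ∧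
      ((∀ x, (∀ a, inn n (p a) x = 0) → endo ω x = 0) → k = 0) := by
  let e : ∀ i, Fin (composition P (![] : Fin 0 → ℝ) 0 i).size → (Fin n → ℝ) := fun i =>
    match i with
    | .inl _ => p
    | .inr (.inl j) => j.elim0
    | .inr (.inr j) => j.elim0
  have he : IsAdapted ω (composition P (![] : Fin 0 → ℝ) 0) e := by
    refine ⟨?_, ?_, ?_⟩
    · rintro (u | j | j)
      · exact hgram
      · exact j.elim0
      · exact j.elim0
    · rintro (u | j | j) (u' | j' | j') hne
      · exact (hne rfl).elim
      all_goals first | exact j'.elim0 | exact j.elim0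
    · rintro (u | j | j)
      · exact hop
      · exact j.elim0
      · exact j.elim0
  refine he.exists_hasNormalForm hω hP n (by omega) (fun j => j.elim0) fun x hx h => ?_
  have hspan : Submodule.span ℝ (Set.range p) ≤ LinearMap.ker ((inn n).flip x) := by
    rw [Submodule.span_le]
    rintro _ ⟨a, rfl⟩
    exact h a
  exact inn_self_pos_of_orthogonal hn hqq hrr hqr (hspan hq) (hspan hr) hx

end Completion

/-! ### Realizing the individual indefinite blocks. -/

section Blocks

variable {n : ℕ} {ω : LinearMap.BilinForm ℝ (Fin n → ℝ)}

theorem inn_self_endo (hω : ω.IsAlt) (x : Fin n → ℝ) : inn n (endo ω x) x = 0 := by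
  rw [inn_endo, hω x]

theorem det_antidiagonal_signs :
    (!![0, 0, 0, -1; 0, 0, 1, 0; 0, 1, 0, 0; -1, 0, 0, 0] : Matrix (Fin 4) (Fin 4) ℝ).det ≠ 0 := by
  simp [Matrix.det_succ_row_zero, Fin.sum_univ_succ, Fin.succAbove]

theorem blockIb_gram_det : blockIb.gram.det ≠ 0 := by
  change (!![0, 0, 1; 0, -1, 0; 1, 0, 0] : Matrix (Fin 3) (Fin 3) ℝ).det ≠ 0
  simp [Matrix.det_fin_three]

theorem blockII_gram_det (ν : ℝ) : (blockII ν).gram.det ≠ 0 := by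
  change (!![-1, 0; 0, -1] : Matrix (Fin 2) (Fin 2) ℝ).det ≠ 0
  simp [Matrix.det_fin_two]

theorem exists_hasNormalForm_blockII (hn : 2 ≤ n) (hω : ω.IsAlt) {x : Fin n → ℝ} {ν : ℝ}
    (hν : ν ≠ 0) (hx : inn n x x < 0) (hbx : endo ω (endo ω x) = -ν ^ 2 • x) :
    ∃ (k l : ℕ) (μ : Fin k → ℝ), (∀ j, μ j ≠ 0) ∧
      HasNormalForm ω (composition (blockII ν) μ l) := by
  obtain ⟨r, hr0, hr⟩ : ∃ r : ℝ, 0 < r ∧ r ^ 2 = -inn n x x :=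
    ⟨√(-inn n x x), Real.sqrt_pos.2 (by linarith), Real.sq_sqrt (by linarith)⟩
  set v := r⁻¹ • x with hv
  set w := ν⁻¹ • endo ω v with hw
  have hvv : inn n v v = -1 := by
    simp only [hv, map_smul, LinearMap.smul_apply, smul_eq_mul]
    field_simp
    linarith
  have hbv : endo ω v = ν • w := by rw [hw, smul_inv_smul₀ hν]
  have hbbv : endo ω (endo ω v) = -ν ^ 2 • v := by
    rw [hv, map_smul, map_smul, hbx, smul_comm]
  have hbw : endo ω w = -ν • v := by
    rw [hw, map_smul, hbbv, smul_smul]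
    congr 1
    field_simp
  have hwv : inn n w v = 0 := by
    simp only [hw, map_smul, LinearMap.smul_apply, inn_self_endo hω, smul_zero]
  have hww : inn n w w = -1 := by
    have h : inn n (ν • w) w = -inn n v (-ν • v) := by rw [← hbv, ← hbw, inn_endo_left hω]
    simp only [map_smul, LinearMap.smul_apply, smul_eq_mul, hvv] at h
    exact mul_left_cancel₀ hν (by linarith)
  obtain ⟨k, l, μ, hμ, h, -⟩ := exists_hasNormalForm_of_block hn hω (blockII_gram_det ν)
    (![v, w] : Fin 2 → (Fin n → ℝ)) (q := v) (r := w) (by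
      change ∀ a c : Fin 2, inn n (![v, w] a) (![v, w] c) = !![-1, 0; 0, -1] a c
      intro a c
      fin_cases a <;> fin_cases c <;> simp [hvv, hww, hwv, inn_comm v w]) (by
      change ∀ a : Fin 2, endo ω (![v, w] a) =
        ∑ c : Fin 2, (!![0, -ν; ν, 0] : Matrix (Fin 2) (Fin 2) ℝ) c a • ![v, w] c
      intro a
      fin_cases a <;> simp [hbv, hbw])
    (Submodule.subset_span ⟨(0 : Fin 2), rfl⟩) (Submodule.subset_span ⟨(1 : Fin 2), rfl⟩)
    (by linarith) (by linarith) (by rw [inn_comm, hwv])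
  exact ⟨k, l, μ, hμ, h⟩

/-- Four vectors with the Gram matrix of the neutral blocks `B_{Ia}` and `B_{IIa}^+`. -/
structure IsNullFrame (p : Fin 4 → (Fin n → ℝ)) : Prop where
  h00 : inn n (p 0) (p 0) = 0
  h01 : inn n (p 0) (p 1) = 0
  h02 : inn n (p 0) (p 2) = 0
  h03 : inn n (p 0) (p 3) = -1
  h11 : inn n (p 1) (p 1) = 0
  h12 : inn n (p 1) (p 2) = 1
  h13 : inn n (p 1) (p 3) = 0
  h22 : inn n (p 2) (p 2) = 0
  h23 : inn n (p 2) (p 3) = 0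
  h33 : inn n (p 3) (p 3) = 0

theorem IsNullFrame.gram {p : Fin 4 → (Fin n → ℝ)} (hp : IsNullFrame p) (a c : Fin 4) :
    inn n (p a) (p c) = (!![0, 0, 0, -1; 0, 0, 1, 0; 0, 1, 0, 0; -1, 0, 0, 0] :
      Matrix (Fin 4) (Fin 4) ℝ) a c := by
  fin_cases a <;> fin_cases c <;>
    simp [hp.h00, hp.h01, hp.h02, hp.h03, hp.h11, hp.h12, hp.h13, hp.h22, hp.h23, hp.h33,
      inn_comm (p 1) (p 0), inn_comm (p 2) (p 0), inn_comm (p 3) (p 0), inn_comm (p 2) (p 1),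
      inn_comm (p 3) (p 1), inn_comm (p 3) (p 2)]

theorem IsNullFrame.exists_hasNormalForm (hn : 2 ≤ n) (hω : ω.IsAlt)
    {p : Fin 4 → (Fin n → ℝ)} (hp : IsNullFrame p) (B : Matrix (Fin 4) (Fin 4) ℝ)
    (hop : ∀ a, endo ω (p a) = ∑ c, B c a • p c) :
    ∃ (k l : ℕ) (μ : Fin k → ℝ), (∀ j, μ j ≠ 0) ∧ HasNormalForm ω (composition
      ⟨4, !![0, 0, 0, -1; 0, 0, 1, 0; 0, 1, 0, 0; -1, 0, 0, 0], B⟩ μ l) ∧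
      ((∀ x, (∀ a, inn n (p a) x = 0) → endo ω x = 0) → k = 0) := by
  have hmem : ∀ a, p a ∈ Submodule.span ℝ (Set.range p) := fun a => Submodule.subset_span ⟨a, rfl⟩
  -- Both `p 0 + p 3` and `p 1 - p 2` have square `-2`.
  refine exists_hasNormalForm_of_block hn hω
    (P := ⟨4, !![0, 0, 0, -1; 0, 0, 1, 0; 0, 1, 0, 0; -1, 0, 0, 0], B⟩)
    det_antidiagonal_signs p hp.gram hop (q := p 0 + p 3) (r := p 1 - p 2)
    (add_mem (hmem 0) (hmem 3)) (sub_mem (hmem 1) (hmem 2)) ?_ ?_ ?_ <;>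
  simp [hp.h00, hp.h01, hp.h02, hp.h03, hp.h11, hp.h12, hp.h13, hp.h22, hp.h23, hp.h33,
      inn_comm (p 3) (p 0), inn_comm (p 2) (p 1), inn_comm (p 3) (p 1), inn_comm (p 3) (p 2)]

theorem exists_hasNormalForm_blockIIaPlus (hn : 2 ≤ n) (hω : ω.IsAlt) {ν : ℝ} (hν : 0 < ν)
    {C : (Fin n → ℝ) →ₗ[ℝ] (Fin n → ℝ)} (hC : ∀ x, C x = endo ω (endo ω x) + ν ^ 2 • x)
    {y : Fin n → ℝ} (hy : 0 < inn n (C y) y) (hCC : C (C y) = 0) :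
    ∃ (k l : ℕ) (μ : Fin k → ℝ), (∀ j, μ j ≠ 0) ∧
      HasNormalForm ω (composition (blockIIaPlus ν) μ l) := by
  have hCsymm : ∀ x y, inn n (C x) y = inn n x (C y) := by
    intro x y
    simp [hC, inn_endo_left hω]
  have hb2 : ∀ x, endo ω (endo ω x) = C x - ν ^ 2 • x := fun x => by rw [hC]; abel
  -- Subtracting a multiple of `C y` makes the vector null without changing its pairing with its
  -- `C`-image. The value `2 * ν` is forced by the block, where `b² + ν²` sends the third basis
  -- vector to `2 * ν` times the second.
  obtain ⟨x, hxx, hx, hCCx⟩ : ∃ x, inn n x x = 0 ∧ inn n (C x) x = 2 * ν ∧ C (C x) = 0 := by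
    obtain ⟨s, hs0, hs⟩ : ∃ s : ℝ, 0 < s ∧ s ^ 2 * inn n (C y) y = 2 * ν :=
      ⟨√(2 * ν / inn n (C y) y), Real.sqrt_pos.2 (by positivity), by
        rw [Real.sq_sqrt (by positivity)]; field_simp⟩
    have hCyCy : inn n (C y) (C y) = 0 := by rw [← hCsymm, hCC]; simp
    refine ⟨s • (y - (inn n y y / (2 * inn n (C y) y)) • C y), ?_, ?_, ?_⟩
    · simp only [map_smul, map_sub, LinearMap.smul_apply, LinearMap.sub_apply, smul_eq_mul, hCyCy,
        inn_comm y (C y)]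
      field_simp
      ring
    · simp only [map_smul, map_sub, LinearMap.smul_apply, smul_eq_mul, hCC, smul_zero,
        sub_zero, hCyCy, mul_zero]
      linarith
    · simp [hCC]
  obtain ⟨u, hu⟩ : ∃ u, u = (2 * ν)⁻¹ • C x := ⟨_, rfl⟩
  have hCu : C u = 0 := by simp [hu, hCCx]
  have hbbu : endo ω (endo ω u) = -ν ^ 2 • u := by rw [hb2, hCu]; simp
  have huu : inn n u u = 0 := by
    have : inn n (C x) (C x) = 0 := by rw [← hCsymm, hCCx]; simp
    simp [hu, this]
  have hux : inn n u x = 1 := by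
    simp only [hu, map_smul, LinearMap.smul_apply, smul_eq_mul, hx]
    field_simp
  have hCx : C x = (2 * ν) • u := by rw [hu, smul_inv_smul₀ (by positivity)]
  obtain ⟨f, hf⟩ : ∃ f, f = -ν⁻¹ • endo ω u := ⟨_, rfl⟩
  have hbu : endo ω u = -ν • f := by
    rw [hf, smul_smul, show -ν * -ν⁻¹ = 1 by field_simp, one_smul]
  have hbf : endo ω f = ν • u := by
    rw [hf, map_smul, hbbu, smul_smul]
    congr 1
    field_simp
  have huf : inn n u f = 0 := by
    rw [hf, map_smul, inn_comm, inn_self_endo hω, smul_zero]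
  have hff : inn n f f = 0 := by
    have h := inn_endo_left hω u f
    rw [hbu, hbf] at h
    simpa [huu, hν.ne'] using h
  have hCb : C (endo ω x) = endo ω (C x) := by simp [hC]
  -- `b` commutes with `C`, so `C b` is skew and `⟨C b x, x⟩ = 0`; up to a nonzero factor this is
  -- `⟨f, x⟩`.
  have hfx : inn n f x = 0 := by
    have h1 := hCsymm x (endo ω x)
    have h2 := inn_endo_left hω (C x) x
    rw [hCb, inn_comm x] at h1
    have h3 : inn n (endo ω (C x)) x = 0 := by linarith
    rw [hCx, map_smul, hbu] at h3
    simpa [hν.ne'] using h3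
  have hbb : endo ω (endo ω x) = (2 * ν) • u - ν ^ 2 • x := by rw [hb2, hCx]
  have hxb : inn n x (endo ω x) = 0 := by rw [inn_comm, inn_self_endo hω]
  have hbxbx : inn n (endo ω x) (endo ω x) = -(2 * ν) := by
    rw [inn_endo_left hω, hbb]
    simp [hxx, inn_comm x u, hux]
  have hfb : inn n f (endo ω x) = -ν := by
    have h := inn_endo_left hω f x
    rw [hbf] at h
    simp only [map_smul, LinearMap.smul_apply, smul_eq_mul, hux] at h
    linarith
  have hub : inn n u (endo ω x) = 0 := by
    have h := inn_endo_left hω u x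
    rw [hbu] at h
    simp only [map_smul, LinearMap.smul_apply, smul_eq_mul, hfx] at h
    linarith
  obtain ⟨g, hg⟩ : ∃ g, g = ν⁻¹ • (endo ω x - f) := ⟨_, rfl⟩
  have hbx : endo ω x = f + ν • g := by rw [hg, smul_inv_smul₀ hν.ne']; abel
  have hbg : endo ω g = u - ν • x := by
    rw [hg, map_smul, map_sub, hbb, hbf, smul_sub, smul_sub, smul_smul, smul_smul, smul_smul,
      show ν⁻¹ * (2 * ν) = 2 by field_simp, show ν⁻¹ * ν ^ 2 = ν by field_simp,
      show ν⁻¹ * ν = 1 by field_simp]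
    module
  have hframe : IsNullFrame ![f, u, x, g] :=
    { h00 := hff
      h01 := (inn_comm _ _).trans huf
      h02 := hfx
      h03 := by
        change inn n f g = -1
        rw [hg, map_smul, map_sub, hfb, hff, smul_eq_mul]
        field_simp
        simp
      h11 := huu
      h12 := hux
      h13 := by
        change inn n u g = 0
        rw [hg, map_smul, map_sub, hub, huf]
        simp
      h22 := hxx
      h23 := by
        change inn n x g = 0
        rw [hg, map_smul, map_sub, hxb, inn_comm x f, hfx]
        simp
      h33 := by
        change inn n g g = 0
        simp only [hg, map_smul, map_sub, LinearMap.smul_apply, LinearMap.sub_apply, smul_eq_mul,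
          hbxbx, hfb, hff, inn_comm (endo ω x) f]
        ring }
  obtain ⟨k, l, μ, hμ, h, -⟩ := hframe.exists_hasNormalForm hn hω
    !![0, -ν, 1, 0; ν, 0, 0, 1; 0, 0, 0, -ν; 0, 0, ν, 0] (by
      intro a
      fin_cases a
      · simp [Fin.sum_univ_four, hbf]
      · simp [Fin.sum_univ_four, hbu]
      · simp [Fin.sum_univ_four, hbx]
      · simp [Fin.sum_univ_four, hbg, sub_eq_add_neg])
  exact ⟨k, l, μ, hμ, h⟩

end Blocks

/-! ### The lightlike and the timelike case. -/

section Classification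

variable {n : ℕ} {ω : LinearMap.BilinForm ℝ (Fin n → ℝ)}

/-- The symmetric bilinear form `⟨b X, b Y⟩`. -/
def endoForm (ω : LinearMap.BilinForm ℝ (Fin n → ℝ)) : LinearMap.BilinForm ℝ (Fin n → ℝ) :=
  (inn n).compl₁₂ (endo ω) (endo ω)

theorem endoForm_apply (x y : Fin n → ℝ) : endoForm ω x y = inn n (endo ω x) (endo ω y) := rfl

theorem endoForm_comm (x y : Fin n → ℝ) : endoForm ω x y = endoForm ω y x := inn_comm _ _

/-- If some timelike vector has a lightlike image, then `ω` is decomposable: it is the wedge of a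
lightlike covector with an orthogonal causal one. -/
theorem exists_wedge_of_lightlike (hn : 2 ≤ n) (hω : ω.IsAlt)
    (hcausal : ∀ x, inn n x x < 0 → endoForm ω x x ≤ 0) {T : Fin n → ℝ} (hT : inn n T T < 0)
    (hbT : endo ω T ≠ 0) (hnull : endoForm ω T T = 0) :
    ∃ u w z : Fin n → ℝ, (∀ x, endo ω x = inn n u x • w - inn n w x • u) ∧ inn n u u = 0 ∧
      inn n u w = 0 ∧ inn n w w ≤ 0 ∧ inn n u z = 1 ∧ inn n w z = 0 ∧ inn n u T = 0 ∧
      inn n w T = -1 := by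
  have hneg : ∀ x, endoForm ω x x ≤ 0 := by
    intro x
    rcases lt_trichotomy (inn n x x) 0 with hx | hx | hx
    · exact hcausal x hx
    · exact apply_self_nonpos_of_null inn_comm endoForm_comm hcausal hT hx
    · have h := apply_self_mul_le_of_neg_of_pos inn_comm endoForm_comm hcausal hT hx
      rw [hnull, zero_mul] at h
      exact nonpos_of_mul_nonneg_right h hT
  obtain ⟨u, hu⟩ : ∃ u, u = endo ω T := ⟨_, rfl⟩
  rw [← hu] at hbT
  have hub : ∀ x, inn n u (endo ω x) = 0 := by
    intro x
    rw [inn_comm, hu, ← endoForm_apply]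
    by_contra hne
    -- The coefficient makes the value of `endoForm` equal to `1`, contradicting semidefiniteness.
    have h := hneg (x + ((1 - endoForm ω x x) / (2 * endoForm ω x T)) • T)
    rw [apply_add_smul_self endoForm_comm, hnull, mul_zero, add_zero] at h
    field_simp at h
    linarith
  have huu : inn n u u = 0 := by
    conv_lhs => rw [hu, ← endoForm_apply, hnull]
  have huT : inn n u T = 0 := by rw [hu, inn_self_endo hω]
  obtain ⟨z, hz⟩ := exists_inn_eq_one hbT
  have hline : ∀ x, inn n u x = 0 → ∃ c : ℝ, endo ω x = c • u := by
    intro x hx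
    set y := endo ω x with hy
    have hTy : inn n T y = 0 := by
      have := inn_endo_left hω T x
      rw [← hu, hx] at this
      linarith
    obtain ⟨z', hz', hTz'⟩ : ∃ z', inn n u z' = 1 ∧ inn n T z' = 0 :=
      ⟨z - (inn n T z / inn n T T) • T, by simp [hz, huT], by
        rw [map_sub, map_smul, smul_eq_mul, div_mul_cancel₀ _ hT.ne, sub_self]⟩
    -- `T` and `p` span a negative definite plane. The part `y - ⟨p, y⟩ u` is orthogonal to it and
    -- has square `⟨y, y⟩ ≤ 0`, so it vanishes.
    obtain ⟨p, hpp, hup, hTp⟩ : ∃ p, inn n p p = -1 ∧ inn n u p = 1 ∧ inn n T p = 0 := by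
      refine ⟨z' + (-(inn n z' z' + 1) / 2) • u, ?_, by simp [hz', huu],
        by simp [hTz', inn_comm T u, huT]⟩
      rw [apply_add_smul_self inn_comm, huu, inn_comm z' u, hz']
      ring
    refine ⟨inn n p y, ?_⟩
    by_contra hne
    have hpos := inn_self_pos_of_orthogonal hn hT (by linarith : inn n p p < 0) hTp
      (x := y - inn n p y • u) (by simp [hTy, inn_comm T u, huT])
      (by simp [inn_comm p u, hup]) (sub_ne_zero.2 hne)
    have huy : inn n u y = 0 := hub x
    have hyy : inn n y y ≤ 0 := hneg x
    rw [sub_eq_add_neg, ← neg_smul, apply_add_smul_self inn_comm, huu, inn_comm y u, huy] at hpos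
    linarith
  have hzz : inn n (endo ω z) z = 0 := inn_self_endo hω z
  refine ⟨u, endo ω z, z, fun x => ?_, huu, hub z, hneg z, hz, hzz, huT, ?_⟩
  · obtain ⟨c, hc⟩ := hline (x - inn n u x • z) (by simp [hz])
    have h := inn_endo_left hω (x - inn n u x • z) z
    rw [hc] at h
    simp only [map_smul, map_sub, LinearMap.smul_apply, LinearMap.sub_apply, smul_eq_mul, hz,
      inn_comm z (endo ω z), hzz, inn_comm x] at h
    rw [map_sub, map_smul, sub_eq_iff_eq_add] at hc
    rw [hc, show c = -inn n (endo ω z) x by linarith]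
    module
  · rw [inn_endo_left hω, ← hu, inn_comm, hz]

theorem hasNormalForm_of_lightlike (hn : 2 ≤ n) (hω : ω.IsAlt)
    (hcausal : ∀ x, inn n x x < 0 → endoForm ω x x ≤ 0) {T : Fin n → ℝ} (hT : inn n T T < 0)
    (hbT : endo ω T ≠ 0) (hnull : endoForm ω T T = 0) :
    ∃ P : Block, (P = blockIa ∨ P = blockIb) ∧
      ∃ l : ℕ, HasNormalForm ω (composition P (![] : Fin 0 → ℝ) l) := by
  obtain ⟨u, w, z, hb, huu, huw, hww, huz, hwz, huT, hwT⟩ :=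
    exists_wedge_of_lightlike hn hω hcausal hT hbT hnull
  have hwu : inn n w u = 0 := by rw [inn_comm, huw]
  rcases hww.eq_or_lt with hww | hww
  · obtain ⟨z', hz'⟩ : ∃ z', z' = z + (-inn n z z / 2) • u := ⟨_, rfl⟩
    have huz' : inn n u z' = 1 := by simp [hz', huz, huu]
    have hwz' : inn n w z' = 0 := by simp [hz', hwz, hwu]
    have hzz' : inn n z' z' = 0 := by
      rw [hz', apply_add_smul_self inn_comm, huu, inn_comm z u, huz]
      ring
    -- `T` is corrected to a null vector orthogonal to `z'`; its pairings with `u` and `w` are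
    -- unaffected.
    obtain ⟨t, ht⟩ : ∃ t, t = T + ((inn n T T / 2) • w + (-inn n z' T) • u) := ⟨_, rfl⟩
    have hut : inn n u t = 0 := by simp [ht, huT, huw, huu]
    have hwt : inn n w t = -1 := by simp [ht, hwT, hww, hwu]
    have hzt : inn n z' t = 0 := by simp [ht, inn_comm z' w, hwz', inn_comm z' u, huz']
    have htt : inn n t t = 0 := by
      simp only [ht, map_add, map_smul, LinearMap.add_apply, LinearMap.smul_apply, smul_eq_mul,
        inn_comm T w, hwT, inn_comm T u, huT, hww, huw, hwu, huu]
      ring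
    have hframe : IsNullFrame ![w, u, z', t] :=
      ⟨hww, hwu, hwz', hwt, huu, huz', hut, hzz', hzt, htt⟩
    obtain ⟨k, l, μ, -, h, hk⟩ := hframe.exists_hasNormalForm hn hω
      !![0, 0, 1, 0; 0, 0, 0, 1; 0, 0, 0, 0; 0, 0, 0, 0] (by
        intro a
        fin_cases a <;>
          simp [Fin.sum_univ_four, hb, hww, huw, hwu, huu, huz', hwz', hut, hwt])
    obtain rfl := hk fun x hx => by
      have h0 : inn n w x = 0 := hx 0
      have h1 : inn n u x = 0 := hx 1
      rw [hb, h0, h1]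
      simp
    obtain rfl : μ = ![] := Subsingleton.elim _ _
    exact ⟨blockIa, .inl rfl, l, h⟩
  · obtain ⟨s, hs0, hs⟩ : ∃ s : ℝ, 0 < s ∧ s ^ 2 = -inn n w w :=
      ⟨√(-inn n w w), Real.sqrt_pos.2 (by linarith), Real.sq_sqrt (by linarith)⟩
    -- Reciprocal scalings preserve the wedge and normalize `f` to square `-1`.
    obtain ⟨e, he⟩ : ∃ e, e = s • u := ⟨_, rfl⟩
    obtain ⟨f, hf⟩ : ∃ f, f = s⁻¹ • w := ⟨_, rfl⟩
    obtain ⟨g, hg⟩ : ∃ g, g = s⁻¹ • z + (-(inn n z z / (2 * s ^ 2))) • e := ⟨_, rfl⟩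
    have hb' : ∀ x, endo ω x = inn n e x • f - inn n f x • e := by
      intro x
      rw [hb, he, hf]
      simp only [map_smul, LinearMap.smul_apply, smul_eq_mul, smul_smul]
      rw [show s * inn n u x * s⁻¹ = inn n u x by field_simp,
        show s⁻¹ * inn n w x * s = inn n w x by field_simp]
    have hee : inn n e e = 0 := by simp [he, huu]
    have hef : inn n e f = 0 := by simp [he, hf, huw]
    have hff : inn n f f = -1 := by
      simp only [hf, map_smul, LinearMap.smul_apply, smul_eq_mul]
      field_simp
      linarith
    have hez : inn n e z = s := by simp [he, huz]
    have heg : inn n e g = 1 := by simp [hg, hee, hez, hs0.ne']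
    have hfg : inn n f g = 0 := by
      simp only [hg, map_add, map_smul, inn_comm f e, hef]
      simp [hf, hwz]
    have hgg : inn n g g = 0 := by
      rw [hg, apply_add_smul_self inn_comm, hee]
      simp only [map_smul, LinearMap.smul_apply, smul_eq_mul, inn_comm z e, hez]
      field_simp
      ring
    obtain ⟨k, l, μ, -, h, hk⟩ := exists_hasNormalForm_of_block hn hω blockIb_gram_det
      (![e, f, g] : Fin 3 → (Fin n → ℝ)) (q := f) (r := e - g) (by
        change ∀ a c : Fin 3, inn n (![e, f, g] a) (![e, f, g] c) =
          !![0, 0, 1; 0, -1, 0; 1, 0, 0] a c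
        intro a c
        fin_cases a <;> fin_cases c <;>
          simp [hee, hef, heg, hff, hfg, hgg, inn_comm f e, inn_comm g e, inn_comm g f]) (by
        change ∀ a : Fin 3, endo ω (![e, f, g] a) =
          ∑ c : Fin 3, (!![0, 1, 0; 0, 0, 1; 0, 0, 0] : Matrix (Fin 3) (Fin 3) ℝ) c a •
            ![e, f, g] c
        intro a
        fin_cases a <;>
          simp [Fin.sum_univ_three, hb', hee, hef, heg, hff, hfg, inn_comm f e])
      (Submodule.subset_span ⟨(1 : Fin 3), rfl⟩)
      (sub_mem (Submodule.subset_span ⟨(0 : Fin 3), rfl⟩)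
        (Submodule.subset_span ⟨(2 : Fin 3), rfl⟩))
      (by linarith) (by simp [hee, heg, hgg, inn_comm g e]) (by simp [inn_comm f e, hef, hfg])
    obtain rfl := hk fun x hx => by
      have h0 : inn n e x = 0 := hx (0 : Fin 3)
      have h1 : inn n f x = 0 := hx (1 : Fin 3)
      rw [hb', h0, h1]
      simp
    obtain rfl : μ = ![] := Subsingleton.elim _ _
    exact ⟨blockIb, .inr rfl, l, h⟩

/-- The range of a self-adjoint endomorphism is the orthogonal complement of its kernel. -/
theorem mem_range_of_orthogonal_ker {C : (Fin n → ℝ) →ₗ[ℝ] (Fin n → ℝ)}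
    (hC : ∀ x y, inn n (C x) y = inn n x (C y)) {x : Fin n → ℝ}
    (hx : ∀ y, C y = 0 → inn n y x = 0) : ∃ y, C y = x := by
  suffices h : x ∈ LinearMap.range C from h
  rw [← LinearMap.BilinForm.orthogonal_orthogonal inn_nondegenerate inn_isRefl
    (LinearMap.range C)]
  intro y hy
  refine hx y (eq_zero_of_inn_eq_zero fun v => ?_)
  rw [hC, inn_comm]
  exact hy _ ⟨v, rfl⟩

theorem hasNormalForm_of_timelike (hn : 2 ≤ n) (hω : ω.IsAlt)
    (htime : ∀ x, inn n x x < 0 → endoForm ω x x < 0) :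
    (∃ ν : ℝ, ν ≠ 0 ∧ ∃ (k l : ℕ) (μ : Fin k → ℝ), (∀ j, μ j ≠ 0) ∧
      HasNormalForm ω (composition (blockII ν) μ l)) ∨
    ∃ ν : ℝ, 0 < ν ∧ ∃ (k l : ℕ) (μ : Fin k → ℝ), (∀ j, μ j ≠ 0) ∧
      HasNormalForm ω (composition (blockIIaPlus ν) μ l) := by
  obtain ⟨T, hT⟩ := exists_timelike hn
  obtain ⟨m, hm0, hm, x, hx0, hxx, hx⟩ := exists_optimal_multiplier inn_comm
    (H := endoForm ω) endoForm_comm (fun x hx => (htime x hx).le) hT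
  obtain ⟨ν, hν0, rfl⟩ : ∃ ν : ℝ, 0 ≤ ν ∧ ν ^ 2 = m := ⟨√m, Real.sqrt_nonneg m, Real.sq_sqrt hm0⟩
  obtain ⟨C, hC⟩ : ∃ C : (Fin n → ℝ) →ₗ[ℝ] (Fin n → ℝ),
      ∀ x, C x = endo ω (endo ω x) + ν ^ 2 • x :=
    ⟨endo ω ∘ₗ endo ω + ν ^ 2 • LinearMap.id, fun x => rfl⟩
  have hCform : ∀ x y, inn n (C x) y = ν ^ 2 * inn n x y - endoForm ω x y := by
    intro x y
    rw [hC, map_add, LinearMap.add_apply, inn_endo_left hω, map_smul, LinearMap.smul_apply,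
      smul_eq_mul, endoForm_apply]
    ring
  have hCsymm : ∀ x y, inn n (C x) y = inn n x (C y) := by
    intro x y
    rw [inn_comm x, hCform, hCform, inn_comm x y, endoForm_comm x y]
  have hCnonneg : ∀ x, 0 ≤ inn n (C x) x := fun x => by rw [hCform]; linarith [hm x]
  have hCker : ∀ x, inn n (C x) x = 0 → C x = 0 := by
    intro x hx
    refine eq_zero_of_inn_eq_zero fun y => ?_
    by_contra hne
    have h := hCnonneg (y + (-(1 + inn n (C y) y) / (2 * inn n (C x) y)) • x)
    have hexp : ∀ t : ℝ, inn n (C (y + t • x)) (y + t • x) =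
        inn n (C y) y + 2 * t * inn n (C x) y := by
      intro t
      simp only [map_add, map_smul, LinearMap.add_apply, LinearMap.smul_apply, smul_eq_mul, hx,
        hCsymm y x, inn_comm y (C x)]
      ring
    rw [hexp] at h
    field_simp at h
    linarith
  have hCx : C x = 0 := hCker x (by rw [hCform, hx, sub_self])
  by_cases hker : ∃ y, C y = 0 ∧ inn n y y < 0
  · obtain ⟨y, hCy, hy⟩ := hker
    have hν : ν ≠ 0 := by
      rintro rfl
      have h := hCform y y
      rw [hCy] at h
      simp only [map_zero, LinearMap.zero_apply] at h
      linarith [htime y hy]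
    refine .inl ⟨ν, hν, exists_hasNormalForm_blockII hn hω hν hy ?_⟩
    rw [hC] at hCy
    rw [neg_smul]
    exact eq_neg_of_add_eq_zero_left hCy
  · push Not at hker
    have hxx0 : inn n x x = 0 := le_antisymm hxx (hker x hCx)
    -- The inner product is nonnegative on `ker C`, so the null vector `x` is orthogonal to all of
    -- `ker C`: otherwise some `y + t x` would have square `-1`.
    obtain ⟨y, hy⟩ := mem_range_of_orthogonal_ker hCsymm (x := x) fun y hy => by
      by_contra hne
      have h := hker (y + (-(1 + inn n y y) / (2 * inn n y x)) • x) (by simp [hy, hCx])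
      rw [apply_add_smul_self inn_comm, hxx0, mul_zero, add_zero] at h
      field_simp at h
      linarith
    have hCy : 0 < inn n (C y) y :=
      lt_of_le_of_ne (hCnonneg y) fun h => hx0 (hy ▸ hCker y h.symm)
    -- For `ν = 0` the vector `b y` is timelike, since its square is `-⟨C y, y⟩`, but its image `b²
    -- y = x` is null.
    have hν : 0 < ν := by
      refine lt_of_le_of_ne hν0 ?_
      rintro rfl
      have h1 := hCform y y
      have hlt : inn n (endo ω y) (endo ω y) < 0 := by
        rw [← endoForm_apply]
        linarith
      have h2 := htime _ hlt
      have h3 : endo ω (endo ω y) = x := by rw [← hy, hC]; simp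
      rw [endoForm_apply, h3, hxx0] at h2
      exact lt_irrefl _ h2
    exact .inr ⟨ν, hν, exists_hasNormalForm_blockIIaPlus hn hω hν hC hCy (by rw [hy, hCx])⟩

end Classification

end PseudoEuclid


theorem corollaryc44 (n : ℕ) (hn : 2 ≤ n)
    (ω : LinearMap.BilinForm ℝ (Fin n → ℝ)) (hω : ω.IsAlt)
    (hcausal : ∀ T : Fin n → ℝ, PseudoEuclid.IsTimelike T →
      PseudoEuclid.CovCausal (PseudoEuclid.interior T ω)) :
    ((∃ T : Fin n → ℝ, PseudoEuclid.IsTimelike T ∧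
        PseudoEuclid.CovLightlike (PseudoEuclid.interior T ω)) →
      ∃ P : PseudoEuclid.Block, (P = PseudoEuclid.blockIa ∨ P = PseudoEuclid.blockIb) ∧
        ∃ l : ℕ, PseudoEuclid.HasNormalForm ω
          (PseudoEuclid.composition P (![] : Fin 0 → ℝ) l)) ∧
    ((∀ T : Fin n → ℝ, PseudoEuclid.IsTimelike T →
        PseudoEuclid.CovTimelike (PseudoEuclid.interior T ω)) →
      ∃ P : PseudoEuclid.Block,
        ((∃ ν : ℝ, ν ≠ 0 ∧ P = PseudoEuclid.blockII ν) ∨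
          (∃ ν : ℝ, 0 < ν ∧ P = PseudoEuclid.blockIIaPlus ν) ∨
          (∃ ν : ℝ, ν < 0 ∧ P = PseudoEuclid.blockIIaMinus ν) ∨
          (∃ ξ ν : ℝ, ξ ≠ 0 ∧ ν ≠ 0 ∧ ξ ^ 2 ≤ ν ^ 2 ∧ P = PseudoEuclid.blockIIb ξ ν)) ∧
        ∃ (k l : ℕ) (μ : Fin k → ℝ), (∀ j, μ j ≠ 0) ∧
          PseudoEuclid.HasNormalForm ω (PseudoEuclid.composition P μ l)) := by
  refine ⟨?_, fun htime => ?_⟩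
  · rintro ⟨T, hT, hbT, hnull⟩
    exact PseudoEuclid.hasNormalForm_of_lightlike hn hω hcausal hT hbT hnull
  · rcases PseudoEuclid.hasNormalForm_of_timelike hn hω htime with
      ⟨ν, hν, k, l, μ, hμ, h⟩ | ⟨ν, hν, k, l, μ, hμ, h⟩
    · exact ⟨_, .inl ⟨ν, hν, rfl⟩, k, l, μ, hμ, h⟩
    · exact ⟨_, .inr (.inl ⟨ν, hν, rfl⟩), k, l, μ, hμ, h⟩
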